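/- **Setting.** A *twin tree* $(T_\pm,\delta^*)$ consists of two trees $T_+,T_-$ and a codistance $\delta^*(x,y)=\delta^*(y,x)\in\mathbf N$ between vertices $x$ of $T_+$ and $y$ of $T_-$ such that, with $m=\delta^*(x,y)$, every neighbour $y'$ of $y$ satisfies $\delta^*(x,y')=m\pm1$, and if $m>0$ exactly one neighbour $y'$ satisfies $\delta^*(x,y')=m+1$; and likewise with $T_+$ and $T_-$ interchanged. Vertices at codistance $0$ are called *opposite*. The group $A=\mathrm{Aut}(T_\pm,\delta^*)$ consists of the pairs $(\alpha_+,\alpha_-)\in\mathrm{Aut}(T_+)\times\mathrm{Aut}(T_-)$ preserving $\delta^*$; it is not required to preserve types. Two vertices of $T_+$ have the same *type* if they are at even distance. A *twin apartment* is a pair of geodesic lines $L_\pm\subset T_\pm$ such that every vertex of $L=L_+\cup L_-$ has a unique opposite in $L$. Number the vertices $(v_i)_{i\in\mathbf Z}$ of $L_+$ consecutively, in either direction, and let $v_i^-$ be the opposite of $v_i$ in $L_-$. The corresponding *twin root* is $a=\{v_i: i\ge 0\}\cup\{v_i^-: i\le 0\}$, and its interior is $\{v_i: i>0\}\cup\{v_i^-: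 i<0\}$. Let $U_a\le A$ be the subgroup of automorphisms fixing $a$ and every edge having a vertex in the interior of $a$. It is called a *root group* if it acts transitively on the set of twin apartments containing $a$. The twin tree is *Moufang* if there is a twin apartment $L$ in which $U_a$ is a root group for every twin root $a\subset L$. Let $\Lambda\le A$ be the subgroup generated by all root groups. Let $(T_\pm,\delta^*)$ be a thick (every vertex has at least three neighbours), locally finite, Moufang twin tree. For a point $x$ of (the geometric realization of) $T_-$, let $\Gamma=\mathrm{Stab}_\Lambda(x)$, viewed as a group of automorphisms of $T_+$ by restriction, and let $$C(\Gamma)=\{g\in\mathrm{Aut}(T_+) : \Gamma\cap g\Gamma g^{-1}\text{ has finite index in }\Gamma\text{ and in }g\Gamma g^{-1}\}$$ be its commensurator in $\mathrm{Aut}(T_+)$. **Lemma.** 1. For any two points $x,x'$ of $T_-$, the groups $\mathrm{Stab}_A(x)$ and $\mathrm{Stab}_A(x')$ are commensurable, i.e. their intersection has finite index in both. 2. The restriction homomorphism $A\to\mathrm{Aut}(T_+)$ is injective and, for any point $x$ of $T_-$, its image is contained in $C(\Gamma)$; in short, $A\le C(\Gamma)$. 3. For any point $x$ of $T_-$, the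 group $C(\Gamma)$ acts transitively on geodesics of given length and type in $T_+$: if $(p_0,\dots,p_n)$ and $(q_0,\dots,q_n)$ are the successive vertices of two geodesics of $T_+$ of the same length $n\ge0$ and $p_0,q_0$ have the same type, then some $g\in C(\Gamma)$ satisfies $g(p_i)=q_i$ for all $i$. If moreover the twin tree has an automorphism $\alpha\in A$ that exchanges the types of the vertices of $T_+$, then $C(\Gamma)$ acts transitively on geodesics of given length in $T_+$: the same conclusion holds without the assumption that $p_0,q_0$ have the same type. -/

import Mathlib

noncomputable section

/-- A twin tree: two trees, on the vertex sets `V` (positive) and `W` (negative), and a codistance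
`codist` between vertices of opposite signs. (The codistance of a pair does not depend on the order
in which the pair is written, so one function `V → W → ℕ` is enough.) -/
structure TwinTree (V : Type*) (W : Type*) where
  /-- the tree `T₊` -/
  pos : SimpleGraph V
  /-- the tree `T₋` -/
  neg : SimpleGraph W
  pos_isTree : pos.IsTree
  neg_isTree : neg.IsTree
  /-- the codistance `δ*` -/
  codist : V → W → ℕ
  codist_neg_adj : ∀ x y y', neg.Adj y y' →
    codist x y' = codist x y + 1 ∨ codist x y' + 1 = codist x y
  codist_neg_unique : ∀ x y, 0 < codist x y →
    ∃! y', neg.Adj y y' ∧ codist x y' = codist x y + 1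
  codist_pos_adj : ∀ x x' y, pos.Adj x x' →
    codist x' y = codist x y + 1 ∨ codist x' y + 1 = codist x y
  codist_pos_unique : ∀ x y, 0 < codist x y →
    ∃! x', pos.Adj x x' ∧ codist x' y = codist x y + 1

namespace SimpleGraph

variable {V : Type*} (G : SimpleGraph V)

/-- A bi-infinite geodesic, parametrized by `ℤ`. -/
def IsGeodesicLine (f : ℤ → V) : Prop :=
  ∀ i j : ℤ, (G.dist (f i) (f j) : ℤ) = |i - j|

/-- `p 0, p 1, …, p n` are the successive vertices of a geodesic of length `n`. -/
def IsGeodesicSegment {n : ℕ} (p : Fin (n + 1) → V) : Prop :=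
  ∀ i j : Fin (n + 1), (G.dist (p i) (p j) : ℤ) = |(i : ℤ) - (j : ℤ)|

/-- In a tree: `u` and `v` have the same type, i.e. they are at even distance. -/
def SameType (u v : V) : Prop := Even (G.dist u v)

/-- An automorphism that exchanges the two types of vertices (of a tree). -/
def IsTypeExchanging (g : G ≃g G) : Prop := ∀ v, ¬ G.SameType v (g v)

/-- The points of the geometric realization of the graph `G`, in barycentric coordinates:
`(1 - t) u + t v` with `0 ≤ t ≤ 1`, where `u` and `v` are adjacent or equal. The vertex `v` is
the point `Finsupp.single v 1`. -/
@[ext]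
structure Point where
  weight : V →₀ ℝ
  mem_edge : ∃ (u v : V) (t : ℝ), (u = v ∨ G.Adj u v) ∧ 0 ≤ t ∧ t ≤ 1 ∧
    weight = Finsupp.single u (1 - t) + Finsupp.single v t

/-- The automorphism group of `G` acts on the geometric realization of `G`. -/
instance : MulAction (G ≃g G) G.Point where
  smul g p :=
    { weight := p.weight.mapDomain g
      mem_edge := by
        obtain ⟨u, v, t, huv, h0, h1, hw⟩ := p.mem_edge
        refine ⟨g u, g v, t, ?_, h0, h1, ?_⟩
        · rcases huv with h | h
          · exact Or.inl (by rw [h])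
          · exact Or.inr (g.map_adj_iff.2 h)
        · rw [hw, Finsupp.mapDomain_add, Finsupp.mapDomain_single, Finsupp.mapDomain_single] }
  one_smul p := Point.ext (Finsupp.mapDomain_id (v := p.weight))
  mul_smul g h p := Point.ext (Finsupp.mapDomain_comp (v := p.weight) (f := h) (g := g))

end SimpleGraph

namespace TwinTree

variable {V W : Type*} (T : TwinTree V W)

/-- Every vertex has at least three neighbours. -/
def IsThick : Prop :=
  (∀ x, 3 ≤ (T.pos.neighborSet x).encard) ∧ (∀ y, 3 ≤ (T.neg.neighborSet y).encard)

/-- Every vertex has finitely many neighbours. -/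
def IsLocallyFinite : Prop :=
  (∀ x, (T.pos.neighborSet x).Finite) ∧ (∀ y, (T.neg.neighborSet y).Finite)

/-- `Aut(T₊) × Aut(T₋)`. -/
abbrev AutProd : Type _ := (T.pos ≃g T.pos) × (T.neg ≃g T.neg)

/-- The group `A` of automorphisms of the twin tree: the pairs of automorphisms of the two trees
that preserve the codistance. -/
def aut : Subgroup T.AutProd where
  carrier := {g | ∀ x y, T.codist (g.1 x) (g.2 y) = T.codist x y}
  one_mem' := fun _ _ => rfl
  mul_mem' := fun {g h} hg hh x y => (hg (h.1 x) (h.2 y)).trans (hh x y)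
  inv_mem' := fun {g} hg x y => by
    have h := hg (g.1⁻¹ x) (g.2⁻¹ y)
    rw [RelIso.apply_inv_self, RelIso.apply_inv_self] at h
    exact h.symm

/-- The stabilizer in a group `H` of automorphisms of a point of the geometric realization
of `T₋`. -/
def stab (H : Subgroup T.AutProd) (x : T.neg.Point) : Subgroup T.AutProd :=
  H ⊓ (MulAction.stabilizer (T.neg ≃g T.neg) x).comap (MonoidHom.snd _ _)

/-- The restriction homomorphism `(α₊, α₋) ↦ α₊`. -/
def toPos : T.AutProd →* (T.pos ≃g T.pos) := MonoidHom.fst _ _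

/-- A twin apartment: a geodesic line in `T₊` and one in `T₋` such that every vertex of their union
has a unique opposite (a vertex at codistance `0`) in the union. -/
structure TwinApartment where
  /-- vertices of the positive line -/
  posLine : Set V
  /-- vertices of the negative line -/
  negLine : Set W
  posLine_geodesic : ∃ f, T.pos.IsGeodesicLine f ∧ Set.range f = posLine
  negLine_geodesic : ∃ f, T.neg.IsGeodesicLine f ∧ Set.range f = negLine
  opposite_pos : ∀ x ∈ posLine, ∃! y, y ∈ negLine ∧ T.codist x y = 0
  opposite_neg : ∀ y ∈ negLine, ∃! x, x ∈ posLine ∧ T.codist x y = 0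

variable {T}

/-- A twin root of the twin apartment `L`. It is given by the numbering `chart` of the positive line
of `L` (in either direction) for which the positive half of the root consists of the vertices
`chart i` with `0 ≤ i`. The boundary of the root consists of `chart 0` and its opposite in `L`;
the negative half consists of the opposites in `L` of the vertices `chart i` with `i ≤ 0`. -/
structure TwinApartment.TwinRoot (L : T.TwinApartment) where
  chart : ℤ → V
  chart_geodesic : T.pos.IsGeodesicLine chart
  range_chart : Set.range chart = L.posLine

namespace TwinApartment.TwinRoot

variable {L : T.TwinApartment} (a : L.TwinRoot)

/-- The positive vertices of the root. -/
def posHalf : Set V := {x | ∃ i, 0 ≤ i ∧ x = a.chart i}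

/-- The negative vertices of the root. -/
def negHalf : Set W := {y | y ∈ L.negLine ∧ ∃ i, i ≤ 0 ∧ T.codist (a.chart i) y = 0}

/-- The positive vertices in the interior of the root. -/
def posInterior : Set V := {x | ∃ i, 0 < i ∧ x = a.chart i}

/-- The negative vertices in the interior of the root. -/
def negInterior : Set W := {y | y ∈ L.negLine ∧ ∃ i, i < 0 ∧ T.codist (a.chart i) y = 0}

/-- The group `U_a` of all automorphisms of the twin tree that fix the twin root `a` and every edge
having a vertex in the interior of `a` (equivalently, `a` and both ends of every such edge). -/
def U : Subgroup T.AutProd where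
  carrier := {g | g ∈ T.aut ∧
    (∀ x ∈ a.posHalf, g.1 x = x) ∧ (∀ y ∈ a.negHalf, g.2 y = y) ∧
    (∀ v ∈ a.posInterior, ∀ x, T.pos.Adj v x → g.1 x = x) ∧
    (∀ v ∈ a.negInterior, ∀ y, T.neg.Adj v y → g.2 y = y)}
  one_mem' := ⟨one_mem _, fun _ _ => rfl, fun _ _ => rfl, fun _ _ _ _ => rfl, fun _ _ _ _ => rfl⟩
  mul_mem' := fun {g _h} hg hh =>
    ⟨mul_mem hg.1 hh.1,
      fun x hx => (congrArg g.1 (hh.2.1 x hx)).trans (hg.2.1 x hx),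
      fun y hy => (congrArg g.2 (hh.2.2.1 y hy)).trans (hg.2.2.1 y hy),
      fun v hv x hx => (congrArg g.1 (hh.2.2.2.1 v hv x hx)).trans (hg.2.2.2.1 v hv x hx),
      fun v hv y hy => (congrArg g.2 (hh.2.2.2.2 v hv y hy)).trans (hg.2.2.2.2 v hv y hy)⟩
  inv_mem' := fun {g} hg =>
    ⟨inv_mem hg.1,
      fun x hx => g.1.symm_apply_eq.2 (hg.2.1 x hx).symm,
      fun y hy => g.2.symm_apply_eq.2 (hg.2.2.1 y hy).symm,
      fun v hv x hx => g.1.symm_apply_eq.2 (hg.2.2.2.1 v hv x hx).symm,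
      fun v hv y hy => g.2.symm_apply_eq.2 (hg.2.2.2.2 v hv y hy).symm⟩

/-- `U_a` is a root group: it is transitive on the set of twin apartments containing `a`. -/
def IsRootGroup : Prop :=
  ∀ M N : T.TwinApartment, a.posHalf ⊆ M.posLine → a.negHalf ⊆ M.negLine →
    a.posHalf ⊆ N.posLine → a.negHalf ⊆ N.negLine →
    ∃ g ∈ a.U, g.1 '' M.posLine = N.posLine ∧ g.2 '' M.negLine = N.negLine

end TwinApartment.TwinRoot

variable (T)

/-- The Moufang property: in some twin apartment, every `U_a` is a root group. -/
def IsMoufang : Prop := ∃ L : T.TwinApartment, ∀ a : L.TwinRoot, a.IsRootGroup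

/-- The group `Λ` generated by all root groups. -/
def rootGroupsSubgroup : Subgroup T.AutProd :=
  Subgroup.closure
    {g | ∃ (L : T.TwinApartment) (a : L.TwinRoot), a.IsRootGroup ∧ g ∈ a.U}

/-- The group `Γ = Stab_Λ(x)`, for a point `x` of `T₋`, as a group of automorphisms of `T₊`. -/
def Γ (x : T.neg.Point) : Subgroup (T.pos ≃g T.pos) :=
  (T.stab T.rootGroupsSubgroup x).map T.toPos

/-- The commensurator `C(Γ)` of `Γ = Stab_Λ(x)` in `Aut(T₊)`. -/
def commΓ (x : T.neg.Point) : Subgroup (T.pos ≃g T.pos) :=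
  Subgroup.Commensurable.commensurator (T.Γ x)

end TwinTree

end

/-!
The argument rests on two facts about a thick Moufang twin tree.

*Extension of twin roots* (`IsTwinChart.exists_extension`). If `a` is a twin root with positive
boundary vertex `v 0`, then every neighbour of `v 0` outside `a` lies in a twin apartment containing
`a`. The missing rays of that apartment are forced by the codistance: one takes upper neighbours
again and again. That the result is a twin apartment follows from the observation that a walk
without backtracking which has begun to descend in codistance keeps descending, since the unique
upper neighbour is the vertex it comes from (`IsCodistance.descend`). Consequently a root group
`U_a` is transitive on the neighbours of `v 0` outside `a`, and with thickness the stabilizer of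
`v 0` in `A` is transitive on all its neighbours. A geodesic can therefore be moved vertex by vertex
onto a fixed line `v`, each time by a root group fixing the part already placed
(`IsMoufangLine.exists_map_path`); rotations around the vertices of `v` identify vertices of `v` at
even distance. So `A` itself is transitive on geodesics of given length and type, and on all
geodesics of given length if some automorphism exchanges types.

*Commensurability* (`SimpleGraph.Point.relIndex_stabilizer`). In a locally finite tree the
stabilizer of a point has finite orbits of vertices, so the stabilizers of any two points in any
group of automorphisms are commensurable. An automorphism of the twin tree permutes the root groups,
hence normalizes `Λ` and conjugates `Γ = Stab_Λ(x)` to the stabilizer of the image of `x`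
(`conj_smul_Γ`); thus `A` lies in the commensurator of `Γ`, and the transitivity above passes
to the commensurator.

Restriction of `A` to `T₊` is injective because the codistances from the vertices of `T₊` separate
the vertices of `T₋` (`exists_codist_ne`): for `y ≠ y'` a remote `x` can be chosen so that the path
from `y` to `y'` descends.
-/

/-! ### Walks without backtracking and the codistance from a fixed vertex -/

namespace SimpleGraph

variable {X : Type*} {G : SimpleGraph X} {h : X → ℕ}

/-- The two axioms satisfied by the codistance from a fixed vertex of one half of a twin tree, as a
function on the vertices of the other half. -/
structure IsCodistance (G : SimpleGraph X) (h : X → ℕ) : Prop where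
  adj : ∀ y y', G.Adj y y' → h y' = h y + 1 ∨ h y' + 1 = h y
  unique : ∀ y, 0 < h y → ∃! y', G.Adj y y' ∧ h y' = h y + 1

/-- `f 0, …, f n` is a walk without backtracking. The values `f i` with `n < i` do not matter. -/
structure IsReducedPath (G : SimpleGraph X) (f : ℕ → X) (n : ℕ) : Prop where
  adj : ∀ i < n, G.Adj (f i) (f (i + 1))
  ne : ∀ i, i + 2 ≤ n → f i ≠ f (i + 2)

theorem IsReducedPath.mono {f : ℕ → X} {m n : ℕ} (hf : G.IsReducedPath f n) (hmn : m ≤ n) :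
    G.IsReducedPath f m :=
  ⟨fun i hi => hf.adj i (by omega), fun i hi => hf.ne i (by omega)⟩

theorem IsReducedPath.map {f : ℕ → X} {n : ℕ} (hf : G.IsReducedPath f n) (g : G ≃g G) :
    G.IsReducedPath (fun i => g (f i)) n :=
  ⟨fun i hi => g.map_adj_iff.2 (hf.adj i hi), fun i hi e => hf.ne i hi (g.injective e)⟩

theorem Walk.IsPath.isReducedPath {u v : X} {p : G.Walk u v} (hp : p.IsPath) :
    G.IsReducedPath p.getVert p.length := by
  refine ⟨fun i hi => p.adj_getVert_succ hi, fun i hi e => ?_⟩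
  have := hp.getVert_injOn (show i ≤ p.length by omega) hi e
  omega

theorem Connected.exists_isReducedPath (hG : G.Connected) (u v : X) :
    ∃ f, G.IsReducedPath f (G.dist u v) ∧ f 0 = u ∧ f (G.dist u v) = v := by
  obtain ⟨p, hp, hl⟩ := hG.exists_path_of_dist u v
  refine ⟨p.getVert, hl ▸ hp.isReducedPath, p.getVert_zero, ?_⟩
  rw [← hl, p.getVert_length]

namespace IsCodistance

variable (H : G.IsCodistance h)
include H

theorem adj_of_zero {y y' : X} (hy : h y = 0) (a : G.Adj y y') : h y' = 1 := by
  have := H.adj _ _ a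
  omega

theorem eq_of_up {y y₁ y₂ : X} (hy : 0 < h y) (a₁ : G.Adj y y₁) (a₂ : G.Adj y y₂)
    (h₁ : h y₁ = h y + 1) (h₂ : h y₂ = h y + 1) : y₁ = y₂ :=
  (H.unique y hy).unique ⟨a₁, h₁⟩ ⟨a₂, h₂⟩

/-- Once a walk without backtracking starts to descend, it descends until it reaches an opposite
vertex: the vertex that it comes from is the unique neighbour of larger codistance. -/
theorem descend {f : ℕ → X} {n m : ℕ} (hf : G.IsReducedPath f n) (h0 : h (f 0) = m + 1)
    (h1 : h (f 1) = m) (hn : n ≤ m + 1) : ∀ i ≤ n, h (f i) + i = m + 1 := by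
  intro i
  induction i using Nat.strong_induction_on with
  | _ i ih =>
    intro hi
    match i with
    | 0 => simpa using h0
    | 1 => omega
    | i + 2 =>
      have e0 := ih i (by omega) (by omega)
      have e1 := ih (i + 1) (by omega) (by omega)
      rcases H.adj _ _ (hf.adj (i + 1) (by omega)) with e | e
      · exact absurd (H.eq_of_up (by omega) (hf.adj i (by omega)).symm (hf.adj (i + 1) (by omega))
          (by omega) e) (hf.ne i hi)
      · change h (f (i + 2)) + 1 = _ at e
        omega

/-- A walk without backtracking that leaves an opposite vertex and meets no other one ascends. -/
theorem ascend {f : ℕ → X} (hf : ∀ n, G.IsReducedPath f n) (h0 : h (f 0) = 0)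
    (hne : ∀ i, h (f i) = 0 → i = 0) (i : ℕ) : h (f i) = i := by
  induction i with
  | zero => exact h0
  | succ i ih =>
    rcases H.adj _ _ ((hf (i + 1)).adj i (by omega)) with e | e
    · omega
    · -- otherwise the walk descends to an opposite vertex, which it reaches at time `2 * i`
      have hi := H.descend (f := fun k => f (i + k)) (n := i) (m := i - 1)
        ⟨fun k hk => (hf (i + k + 1)).adj _ (by omega), fun k _ => (hf (i + k + 2)).ne _ le_rfl⟩
        (by simp only [add_zero]; omega) (by omega) (by omega) i le_rfl
      have := hne (i + i) (by omega)
      omega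

theorem add_length_even {u v : X} (p : G.Walk u v) : Even (p.length + (h u + h v)) := by
  induction p with
  | nil => simp
  | cons a p ih =>
    rw [Walk.length_cons]
    rw [Nat.even_iff] at *
    rcases H.adj _ _ a with e | e <;> omega

theorem le_add_length {u v : X} (p : G.Walk u v) : h v ≤ h u + p.length := by
  induction p with
  | nil => simp
  | cons a p ih =>
    rw [Walk.length_cons]
    rcases H.adj _ _ a with e | e <;> omega

theorem dist_add_even (hG : G.Connected) (u v : X) : Even (G.dist u v + (h u + h v)) := by
  obtain ⟨p, hp⟩ := hG.exists_walk_length_eq_dist u v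
  exact hp ▸ H.add_length_even p

theorem le_add_dist (hG : G.Connected) (u v : X) : h v ≤ h u + G.dist u v := by
  obtain ⟨p, hp⟩ := hG.exists_walk_length_eq_dist u v
  exact hp ▸ H.le_add_length p

theorem exists_up {y : X} (hy : 0 < h y) : ∃ y', G.Adj y y' ∧ h y' = h y + 1 :=
  (H.unique y hy).exists

theorem exists_eq_zero [Nonempty X] (hG : ∀ x, (G.neighborSet x).Nontrivial) : ∃ x, h x = 0 := by
  by_contra! hne
  -- a vertex of least codistance has a neighbour that is not its upper neighbour
  obtain ⟨x, hx⟩ : ∃ x, ∀ y, h x ≤ h y :=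
    ⟨Function.argmin h, fun y => Function.argmin_le h y⟩
  obtain ⟨y₁, h₁, y₂, h₂, hy⟩ := hG x
  have m₁ := hx y₁
  have m₂ := hx y₂
  have a₁ := H.adj _ _ h₁
  have a₂ := H.adj _ _ h₂
  exact hy (H.eq_of_up (Nat.pos_of_ne_zero (hne x)) h₁ h₂ (by omega) (by omega))

/-- The ray along which the codistance grows. -/
theorem exists_ray {y : X} (hy : 0 < h y) :
    ∃ r : ℕ → X, r 0 = y ∧ (∀ k, G.Adj (r k) (r (k + 1))) ∧ ∀ k, h (r k) = h y + k := by
  classical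
  choose! up hadj hup using fun z => H.exists_up (y := z)
  have key : ∀ k, h (up^[k] y) = h y + k := by
    intro k
    induction k with
    | zero => rfl
    | succ k ih => rw [Function.iterate_succ_apply', hup _ (by omega), ih]; rfl
  refine ⟨fun k => up^[k] y, rfl, fun k => ?_, key⟩
  simp only [Function.iterate_succ_apply']
  exact hadj _ (by rw [key]; omega)

end IsCodistance

/-- Vertices of a bi-infinite walk are at most as far apart as their indices. -/
theorem Connected.dist_le_of_adj (hG : G.Connected) {F : ℤ → X}
    (hF : ∀ i, G.Adj (F i) (F (i + 1))) (i : ℤ) (k : ℕ) : G.dist (F i) (F (i + k)) ≤ k := by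
  induction k with
  | zero => simp
  | succ k ih =>
    have h1 := hG.dist_triangle (u := F i) (v := F (i + k)) (w := F (i + k + 1))
    rw [dist_eq_one_iff_adj.2 (hF (i + k))] at h1
    push_cast
    rw [← add_assoc]
    omega

theorem IsCodistance.abs_sub_le (H : G.IsCodistance h) (hG : G.Connected) {F : ℤ → X}
    (hF : ∀ i, G.Adj (F i) (F (i + 1))) (i j : ℤ) :
    |(h (F i) : ℤ) - h (F j)| ≤ |i - j| := by
  wlog hij : i ≤ j generalizing i j
  · rw [abs_sub_comm, abs_sub_comm i]
    exact this j i (by omega)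
  obtain ⟨k, rfl⟩ := Int.le.dest hij
  have h0 := hG.dist_le_of_adj hF i k
  have h1 := H.le_add_dist hG (F i) (F (i + k))
  have h2 := H.le_add_dist hG (F (i + k)) (F i)
  rw [dist_comm] at h2
  rw [abs_le]
  simp only [sub_add_cancel_left, abs_neg, Nat.abs_cast]
  omega

theorem IsGeodesicLine.adj {F : ℤ → X} (hF : G.IsGeodesicLine F) (i : ℤ) :
    G.Adj (F i) (F (i + 1)) := by
  have := hF i (i + 1)
  rw [sub_add_cancel_left] at this
  exact dist_eq_one_iff_adj.1 (by simpa using this)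

theorem IsGeodesicLine.injective {F : ℤ → X} (hF : G.IsGeodesicLine F) :
    Function.Injective F := by
  intro i j e
  have := hF i j
  rw [e, dist_self] at this
  simpa [sub_eq_zero, eq_comm] using this

theorem IsGeodesicLine.shift {F : ℤ → X} (hF : G.IsGeodesicLine F) (k : ℤ) :
    G.IsGeodesicLine fun i => F (k + i) := fun i j => by
  rw [hF, add_sub_add_left_eq_sub]

theorem IsGeodesicLine.reflect {F : ℤ → X} (hF : G.IsGeodesicLine F) :
    G.IsGeodesicLine fun i => F (-i) := fun i j => by
  rw [hF, abs_sub_comm, sub_neg_eq_add, neg_add_eq_sub]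

theorem IsGeodesicLine.isReducedPath {F : ℤ → X} (hF : G.IsGeodesicLine F) (n : ℕ) :
    G.IsReducedPath (fun k : ℕ => F k) n :=
  ⟨fun i _ => by exact_mod_cast hF.adj i, fun i _ e => by
    have := hF.injective e
    push_cast at this
    omega⟩

/-- Mapping walks in both directions: automorphisms are isometries. -/
theorem Connected.dist_map (hG : G.Connected) (g : G ≃g G) (u v : X) :
    G.dist (g u) (g v) = G.dist u v := by
  have key : ∀ (g : G ≃g G) (u v : X), G.dist (g u) (g v) ≤ G.dist u v := by
    intro g u v
    obtain ⟨p, hp⟩ := hG.exists_walk_length_eq_dist u v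
    have := dist_le (p.map g.toHom)
    rwa [Walk.length_map, hp] at this
  refine (key g u v).antisymm ?_
  simpa using key g.symm (g u) (g v)

theorem IsGeodesicLine.map (hG : G.Connected) {F : ℤ → X} (hF : G.IsGeodesicLine F)
    (g : G ≃g G) : G.IsGeodesicLine fun i => g (F i) := fun i j => by
  rw [← hF i j, hG.dist_map]

/-- A geodesic segment is a walk without backtracking; the values beyond its last vertex are
irrelevant. -/
theorem IsGeodesicSegment.exists_isReducedPath {n : ℕ} {p : Fin (n + 1) → X}
    (hp : G.IsGeodesicSegment p) :
    ∃ f : ℕ → X, G.IsReducedPath f n ∧ ∀ i : Fin (n + 1), f i = p i := by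
  have hd : ∀ i j (hi : i < n + 1) (hj : j < n + 1),
      (G.dist (p (Fin.ofNat _ i)) (p (Fin.ofNat _ j)) : ℤ) = |(i : ℤ) - j| := by
    intro i j hi hj
    rw [hp]
    simp [Nat.mod_eq_of_lt hi, Nat.mod_eq_of_lt hj]
  refine ⟨fun i => p (Fin.ofNat _ i), ⟨fun i hi => ?_, fun i hi e => ?_⟩, fun i => by simp⟩
  · have := hd i (i + 1) (by omega) (by omega)
    push_cast at this
    rw [sub_add_cancel_left, abs_neg, abs_one] at this
    exact dist_eq_one_iff_adj.1 (by exact_mod_cast this)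
  · have := hd i (i + 2) (by omega) (by omega)
    rw [e, dist_self] at this
    push_cast at this
    rw [sub_add_cancel_left, abs_neg] at this
    norm_num at this

theorem IsGeodesicSegment.map (hG : G.Connected) {n : ℕ}
    {p : Fin (n + 1) → X} (hp : G.IsGeodesicSegment p) (g : G ≃g G) :
    G.IsGeodesicSegment fun i => g (p i) := fun i j => by
  rw [hG.dist_map, hp]

/-- Along a geodesic line with a single opposite vertex, the codistance is the distance from that
vertex. -/
theorem IsCodistance.eq_abs (H : G.IsCodistance h) {F : ℤ → X} (hF : G.IsGeodesicLine F) {i : ℤ}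
    (h0 : h (F i) = 0) (hne : ∀ j, h (F j) = 0 → j = i) (j : ℤ) : (h (F j) : ℤ) = |j - i| := by
  rcases le_total i j with hij | hij
  · obtain ⟨k, rfl⟩ := Int.le.dest hij
    rw [H.ascend (f := fun k : ℕ => F (i + k)) (hF.shift i).isReducedPath (by simpa using h0)
      (fun k hk => by have := hne _ hk; omega) k]
    simp
  · obtain ⟨k, rfl⟩ := Int.le.dest hij
    have := H.ascend (f := fun l : ℕ => F (j + k + -l)) ((hF.shift (j + k)).reflect.isReducedPath)
      (by simpa using h0) (fun l hl => by have := hne _ hl; omega) k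
    rw [add_neg_cancel_right] at this
    rw [this]
    simp

end SimpleGraph

/-! ### Twin apartments in coordinates -/

namespace TwinTree

variable {V W : Type*} {T : TwinTree V W}

theorem isCodistance_neg (T : TwinTree V W) (x : V) : T.neg.IsCodistance (T.codist x) :=
  ⟨T.codist_neg_adj x, T.codist_neg_unique x⟩

theorem isCodistance_pos (T : TwinTree V W) (y : W) :
    T.pos.IsCodistance (fun x => T.codist x y) :=
  ⟨fun x x' => T.codist_pos_adj x x' y, fun x => T.codist_pos_unique x y⟩

theorem pos_connected (T : TwinTree V W) : T.pos.Connected := T.pos_isTree.connected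

theorem neg_connected (T : TwinTree V W) : T.neg.Connected := T.neg_isTree.connected

/-- If a vertex `x'` is the upper neighbour of `x` with respect to `y`, then it is also the upper
neighbour of `x` with respect to the upper neighbour of `y`. -/
theorem codist_square {x x' : V} {y y' : W} {m : ℕ} (hm : 0 < m) (hx : T.pos.Adj x x')
    (hy : T.neg.Adj y y') (h : T.codist x y = m) (h₁ : T.codist x y' = m + 1)
    (h₂ : T.codist x' y = m + 1) : T.codist x' y' = m + 2 := by
  obtain ⟨u, hu, hu'⟩ := (T.isCodistance_pos y').exists_up (y := x) (by omega)
  have e1 := T.codist_neg_adj u y y' hy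
  have e2 := T.codist_pos_adj x u y hu
  rw [(T.isCodistance_pos y).eq_of_up (by omega) hx hu (by omega) (by omega)]
  omega

variable (T) in
/-- Numberings of two lines, in the two trees, for which the codistance of two vertices is the
difference of their numbers; in particular vertices with the same number are opposite. -/
structure IsTwinChart (v : ℤ → V) (w : ℤ → W) : Prop where
  adj_pos : ∀ i, T.pos.Adj (v i) (v (i + 1))
  adj_neg : ∀ i, T.neg.Adj (w i) (w (i + 1))
  codist_eq : ∀ i j, (T.codist (v i) (w j) : ℤ) = |i - j|

namespace IsTwinChart

variable {v : ℤ → V} {w : ℤ → W} (C : T.IsTwinChart v w)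
include C

theorem codist_eq_zero_iff {i j : ℤ} : T.codist (v i) (w j) = 0 ↔ i = j := by
  rw [← Int.natCast_inj, C.codist_eq, Nat.cast_zero, abs_eq_zero, sub_eq_zero]

/-- The codistance from a remote vertex of the other line bounds the distance from below. -/
theorem geodesic_pos : T.pos.IsGeodesicLine v := by
  intro i j
  wlog hij : i ≤ j generalizing i j
  · rw [SimpleGraph.dist_comm, abs_sub_comm]
    exact this j i (by omega)
  obtain ⟨k, rfl⟩ := Int.le.dest hij
  have h0 := T.pos_connected.dist_le_of_adj C.adj_pos i k
  have h1 := (T.isCodistance_pos (w i)).le_add_dist T.pos_connected (v i) (v (i + k))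
  have h2 := C.codist_eq i i
  have h3 := C.codist_eq (i + k) i
  simp only [sub_self, abs_zero, add_sub_cancel_left, Nat.abs_cast, sub_add_cancel_left,
    abs_neg] at *
  omega

theorem geodesic_neg : T.neg.IsGeodesicLine w := by
  intro i j
  wlog hij : i ≤ j generalizing i j
  · rw [SimpleGraph.dist_comm, abs_sub_comm]
    exact this j i (by omega)
  obtain ⟨k, rfl⟩ := Int.le.dest hij
  have h0 := T.neg_connected.dist_le_of_adj C.adj_neg i k
  have h1 := (T.isCodistance_neg (v i)).le_add_dist T.neg_connected (w i) (w (i + k))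
  have h2 := C.codist_eq i i
  have h3 := C.codist_eq i (i + k)
  simp only [sub_self, abs_zero, Nat.abs_cast, sub_add_cancel_left, abs_neg] at *
  omega

/-- The twin apartment covered by a pair of numberings. -/
def toTwinApartment : T.TwinApartment where
  posLine := Set.range v
  negLine := Set.range w
  posLine_geodesic := ⟨v, C.geodesic_pos, rfl⟩
  negLine_geodesic := ⟨w, C.geodesic_neg, rfl⟩
  opposite_pos := by
    rintro _ ⟨i, rfl⟩
    refine ⟨w i, ⟨⟨i, rfl⟩, C.codist_eq_zero_iff.2 rfl⟩, ?_⟩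
    rintro _ ⟨⟨j, rfl⟩, hj⟩
    rw [C.codist_eq_zero_iff.1 hj]
  opposite_neg := by
    rintro _ ⟨i, rfl⟩
    refine ⟨v i, ⟨⟨i, rfl⟩, C.codist_eq_zero_iff.2 rfl⟩, ?_⟩
    rintro _ ⟨⟨j, rfl⟩, hj⟩
    rw [C.codist_eq_zero_iff.1 hj]

end IsTwinChart

/-- Every numbering of the positive line of a twin apartment extends to a numbering of both
lines. -/
theorem TwinApartment.exists_isTwinChart (L : T.TwinApartment) {v : ℤ → V}
    (hv : T.pos.IsGeodesicLine v) (hr : Set.range v = L.posLine) :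
    ∃ w, T.IsTwinChart v w ∧ Set.range w = L.negLine := by
  obtain ⟨f, hf, hfr⟩ := L.negLine_geodesic
  have hσ : ∀ i, ∃ s, T.codist (v i) (f s) = 0 ∧ ∀ j, T.codist (v i) (f j) = 0 → j = s := by
    intro i
    obtain ⟨y, ⟨hy, hy0⟩, huniq⟩ := L.opposite_pos (v i) (hr ▸ ⟨i, rfl⟩)
    rw [← hfr] at hy
    obtain ⟨s, rfl⟩ := hy
    exact ⟨s, hy0, fun j hj => hf.injective (huniq _ ⟨hfr ▸ ⟨j, rfl⟩, hj⟩)⟩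
  have hτ : ∀ j, ∃ t, T.codist (v t) (f j) = 0 ∧ ∀ i, T.codist (v i) (f j) = 0 → i = t := by
    intro j
    obtain ⟨x, ⟨hx, hx0⟩, huniq⟩ := L.opposite_neg (f j) (hfr ▸ ⟨j, rfl⟩)
    rw [← hr] at hx
    obtain ⟨t, rfl⟩ := hx
    exact ⟨t, hx0, fun i hi => hv.injective (huniq _ ⟨hr ▸ ⟨i, rfl⟩, hi⟩)⟩
  choose s hs hs' using hσ
  choose t ht ht' using hτ
  have hts : ∀ i, t (s i) = i := fun i => (ht' _ _ (hs i)).symm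
  have hst : ∀ j, s (t j) = j := fun j => (hs' _ _ (ht j)).symm
  have c1 : ∀ i j, (T.codist (v i) (f j) : ℤ) = |j - s i| := fun i j =>
    (T.isCodistance_neg (v i)).eq_abs hf (hs i) (hs' i) j
  have c2 : ∀ i j, (T.codist (v i) (f j) : ℤ) = |i - t j| := fun i j =>
    (T.isCodistance_pos (f j)).eq_abs hv (ht j) (ht' j) i
  refine ⟨fun i => f (s i), ⟨hv.adj, fun i => ?_, fun i j => by rw [c2, hts]⟩, ?_⟩
  · -- the codistance turns the numbers `s i` of the opposites into an isometry of `ℤ`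
    have h1 := hf (s (i + 1)) (s i)
    rw [← c1, c2, hts, sub_add_cancel_left, abs_neg, abs_one] at h1
    rw [SimpleGraph.dist_comm] at h1
    exact SimpleGraph.dist_eq_one_iff_adj.1 (by exact_mod_cast h1)
  · rw [← hfr]
    exact Set.Subset.antisymm (by rintro _ ⟨i, rfl⟩; exact ⟨s i, rfl⟩)
      (by rintro _ ⟨j, rfl⟩; exact ⟨t j, congrArg f (hst j)⟩)

end TwinTree

namespace TwinTree

variable {V W : Type*} {T : TwinTree V W}

/-- Twin apartments containing a given twin root reach every vertex next to its boundary: if `x` is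
a neighbour of `v 0` other than `v 1`, then some twin apartment contains `x` together with all `v i`
for `0 ≤ i` and all `w j` for `j ≤ 0`. Its remaining vertices lie on the ray from `x` along which
the codistance from `w 0` grows, and on the ray from `w 0` along which the codistance from `x`
grows. -/
theorem IsTwinChart.exists_extension {v : ℤ → V} {w : ℤ → W} (C : T.IsTwinChart v w) {x : V}
    (hx : T.pos.Adj (v 0) x) (hne : x ≠ v 1) :
    ∃ v' w', T.IsTwinChart v' w' ∧ (∀ i, 0 ≤ i → v' i = v i) ∧ v' (-1) = x ∧
      ∀ j ≤ 0, w' j = w j := by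
  have hx1 : T.codist x (w 0) = 1 :=
    (T.isCodistance_pos (w 0)).adj_of_zero (C.codist_eq_zero_iff.2 rfl) hx
  obtain ⟨r, r0, radj, hr⟩ := (T.isCodistance_pos (w 0)).exists_ray (y := x) (by omega)
  obtain ⟨s, s0, sadj, hs⟩ := (T.isCodistance_neg x).exists_ray (y := w 0) (by omega)
  obtain ⟨v', hv, hvr⟩ : ∃ v' : ℤ → V, (∀ i, 0 ≤ i → v' i = v i) ∧ ∀ k : ℕ, v' (-1 - k) = r k :=
    ⟨fun i => if 0 ≤ i then v i else r (-1 - i).toNat, fun i hi => if_pos hi, fun k => by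
      simp only [if_neg (show ¬ (0 : ℤ) ≤ -1 - k by omega)]
      congr 1
      omega⟩
  obtain ⟨w', hw, hws⟩ : ∃ w' : ℤ → W, (∀ j ≤ 0, w' j = w j) ∧ ∀ k : ℕ, w' k = s k :=
    ⟨fun j => if j ≤ 0 then w j else s j.toNat, fun j hj => if_pos hj, fun k => by
      dsimp only
      split_ifs with hk
      · obtain rfl : k = 0 := by omega
        exact s0.symm
      · rfl⟩
  have hv1 : v' (-1) = x := by simpa [r0] using hvr 0
  have adjv : ∀ i, T.pos.Adj (v' i) (v' (i + 1)) := by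
    intro i
    rcases lt_trichotomy i (-1) with hi | rfl | hi
    · obtain ⟨k, rfl⟩ : ∃ k : ℕ, i = -1 - (k + 1 : ℕ) := ⟨(-2 - i).toNat, by omega⟩
      rw [show (-1 - (k + 1 : ℕ) + 1 : ℤ) = -1 - (k : ℕ) by push_cast; ring, hvr, hvr]
      exact (radj k).symm
    · rw [hv1, neg_add_cancel, hv 0 le_rfl]
      exact hx.symm
    · rw [hv i (by omega), hv (i + 1) (by omega)]
      exact C.adj_pos i
  have adjw : ∀ j, T.neg.Adj (w' j) (w' (j + 1)) := by
    intro j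
    rcases lt_or_ge j 0 with hj | hj
    · rw [hw j (by omega), hw (j + 1) (by omega)]
      exact C.adj_neg j
    · lift j to ℕ using hj
      have := hws (j + 1)
      push_cast at this
      rw [this, hws]
      exact sadj j
  -- the codistances from `w 0` and from `x`, which are known by construction
  have A : ∀ i ≤ 0, (T.codist (v' i) (w' 0) : ℤ) = -i := by
    intro i hi
    rw [hw 0 le_rfl]
    rcases hi.lt_or_eq with hi | rfl
    · obtain ⟨k, rfl⟩ : ∃ k : ℕ, i = -1 - k := ⟨(-1 - i).toNat, by omega⟩
      rw [hvr, hr, hx1]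
      push_cast
      ring
    · rw [hv 0 le_rfl, C.codist_eq]
      rfl
  have B : ∀ j, 0 ≤ j → (T.codist (v' (-1)) (w' j) : ℤ) = j + 1 := by
    intro j hj
    lift j to ℕ using hj
    rw [hv1, hws, hs, hx1]
    push_cast
    ring
  have lipv : ∀ i i' j, |(T.codist (v' i) (w' j) : ℤ) - T.codist (v' i') (w' j)| ≤ |i - i'| :=
    fun i i' j => (T.isCodistance_pos (w' j)).abs_sub_le T.pos_connected adjv i i'
  have lipw : ∀ i j j', |(T.codist (v' i) (w' j) : ℤ) - T.codist (v' i) (w' j')| ≤ |j - j'| :=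
    fun i j j' => (T.isCodistance_neg (v' i)).abs_sub_le T.neg_connected adjw j j'
  have Q₁ : ∀ i j, 0 ≤ i → j ≤ 0 → (T.codist (v' i) (w' j) : ℤ) = |i - j| := by
    intro i j hi hj
    rw [hv i hi, hw j hj, C.codist_eq]
  -- seen from `w j` with `j ≤ 0`, the line `v'` descends from `v 1` to the opposite of `w j`
  have Q₂ : ∀ i j, j ≤ i → i ≤ 0 → (T.codist (v' i) (w' j) : ℤ) = i - j := by
    intro i j hij hi
    have h0 := Q₁ 1 j (by omega) (by omega)
    have h1 := Q₁ 0 j (by omega) (by omega)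
    rw [abs_of_nonneg (by omega)] at h0 h1
    have hred : T.pos.IsReducedPath (fun k : ℕ => v' (1 - k)) (1 - j).toNat := by
      refine ⟨fun k _ => ?_, fun k _ e => ?_⟩
      · have := (adjv (1 - (k + 1 : ℕ))).symm
        rwa [show (1 - (k + 1 : ℕ) + 1 : ℤ) = 1 - (k : ℕ) by push_cast; ring] at this
      · rcases Nat.eq_zero_or_pos k with rfl | hk
        · apply hne
          rw [← hv 1 (by omega), ← hv1]
          simpa using e.symm
        · have e1 := A (1 - k) (by omega)
          have e2 := A (1 - (k + 2 : ℕ)) (by omega)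
          rw [e] at e1
          omega
    have := (T.isCodistance_pos (w' j)).descend (m := (-j).toNat) hred
      (by simp only [Nat.cast_zero, sub_zero]; omega)
      (by simp only [Nat.cast_one, sub_self]; omega) (by omega) (1 - i).toNat (by omega)
    rw [show (1 - ((1 - i).toNat : ℤ)) = i by omega] at this
    omega
  have Q₂' : ∀ i j, i ≤ j → j ≤ 0 → (T.codist (v' i) (w' j) : ℤ) = j - i := by
    intro i j hij hj
    have h0 := Q₂ i i le_rfl (by omega)
    have h1 := A i (by omega)
    have h2 := abs_le.1 (lipw i j i)
    have h3 := abs_le.1 (lipw i 0 j)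
    rw [abs_of_nonneg (by omega)] at h2 h3
    omega
  -- seen from `v i` with `0 ≤ i`, the line `w'` descends from `w (-1)` to the opposite of `v i`
  have Q₃ : ∀ i j, 0 ≤ j → j ≤ i → (T.codist (v' i) (w' j) : ℤ) = i - j := by
    intro i j hj hij
    have h0 := Q₁ i (-1) (by omega) (by omega)
    have h1 := Q₁ i 0 (by omega) (by omega)
    rw [abs_of_nonneg (by omega)] at h0 h1
    have hx0 := Q₂ (-1) (-1) le_rfl (by omega)
    have hred : T.neg.IsReducedPath (fun k : ℕ => w' (k - 1)) (i + 1).toNat := by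
      refine ⟨fun k _ => ?_, fun k _ e => ?_⟩
      · have := adjw (k - 1)
        rwa [show ((k : ℤ) - 1 + 1) = (k + 1 : ℕ) - 1 by push_cast; ring] at this
      · have e2 := B ((k + 2 : ℕ) - 1) (by omega)
        rw [← e] at e2
        rcases Nat.eq_zero_or_pos k with rfl | hk
        · simp only [Nat.cast_zero, zero_sub] at e2
          omega
        · have e1 := B (k - 1) (by omega)
          omega
    have := (T.isCodistance_neg (v' i)).descend (m := i.toNat) hred
      (by simp only [Nat.cast_zero, zero_sub]; omega)
      (by simp only [Nat.cast_one, sub_self]; omega) (by omega) (j + 1).toNat (by omega)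
    rw [show (((j + 1).toNat : ℤ) - 1) = j by omega] at this
    omega
  have Q₃' : ∀ i j, 0 ≤ i → i ≤ j → (T.codist (v' i) (w' j) : ℤ) = j - i := by
    intro i j hi hij
    have h0 := Q₃ j j (by omega) le_rfl
    have h1 := B j (by omega)
    have h2 := abs_le.1 (lipv i j j)
    have h3 := abs_le.1 (lipv (-1) i j)
    rw [abs_of_nonpos (by omega)] at h2 h3
    omega
  -- the two new rays diverge
  have Q₄ : ∀ k j : ℕ, (T.codist (v' (-1 - k)) (w' j) : ℤ) = j + 1 + k := by
    intro k
    induction k with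
    | zero => intro j; simpa using B j (by omega)
    | succ k ihk =>
      intro j
      induction j with
      | zero =>
        have := A (-1 - (k + 1 : ℕ)) (by omega)
        simp only [Nat.cast_zero]
        omega
      | succ j ihj =>
        have a := (adjv (-1 - (k + 1 : ℕ))).symm
        rw [show (-1 - (k + 1 : ℕ) + 1 : ℤ) = -1 - (k : ℕ) by push_cast; ring] at a
        have b := adjw j
        have e1 := ihk j
        have e2 := ihk (j + 1)
        have := codist_square (m := j + 1 + k) (by omega) a b (by omega)
          (by push_cast at e2; omega) (by omega)
        push_cast at this ⊢
        rw [this]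
        push_cast
        ring
  refine ⟨v', w', ⟨adjv, adjw, fun i j => ?_⟩, hv, hv1, hw⟩
  rcases le_total 0 i with hi | hi <;> rcases le_total 0 j with hj | hj
  · rcases le_total i j with hij | hij
    · rw [Q₃' i j hi hij, abs_of_nonpos (by omega)]; ring
    · rw [Q₃ i j hj hij, abs_of_nonneg (by omega)]
  · exact Q₁ i j hi hj
  · rcases hi.lt_or_eq with hi | rfl
    · lift j to ℕ using hj
      obtain ⟨k, rfl⟩ : ∃ k : ℕ, i = -1 - k := ⟨(-1 - i).toNat, by omega⟩
      rw [Q₄, abs_of_nonpos (by omega)]; ring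
    · rw [Q₃' 0 j le_rfl hj, abs_of_nonpos (by omega)]; ring
  · rcases le_total i j with hij | hij
    · rw [Q₂' i j hij hj, abs_of_nonpos (by omega)]; ring
    · rw [Q₂ i j hij hi, abs_of_nonneg (by omega)]

end TwinTree

/-! ### Transitivity on geodesics -/

namespace TwinTree

variable {V W : Type*} {T : TwinTree V W}

variable (T) in
/-- `v` numbers, in either direction, the positive line of a twin apartment all of whose twin roots
have root groups. -/
def IsMoufangLine (v : ℤ → V) : Prop :=
  ∃ L : T.TwinApartment, (∀ a : L.TwinRoot, a.IsRootGroup) ∧ T.pos.IsGeodesicLine v ∧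
    Set.range v = L.posLine

theorem IsMoufang.exists_isMoufangLine (hT : T.IsMoufang) : ∃ v, T.IsMoufangLine v := by
  obtain ⟨L, hL⟩ := hT
  obtain ⟨v, hv, hr⟩ := L.posLine_geodesic
  exact ⟨v, L, hL, hv, hr⟩

namespace IsMoufangLine

variable {v : ℤ → V} (hv : T.IsMoufangLine v)
include hv

theorem geodesic : T.pos.IsGeodesicLine v := hv.choose_spec.2.1

theorem adj (i : ℤ) : T.pos.Adj (v i) (v (i + 1)) := hv.geodesic.adj i

theorem adj_pred (i : ℤ) : T.pos.Adj (v i) (v (i - 1)) := by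
  simpa using (hv.adj (i - 1)).symm

theorem shift (k : ℤ) : T.IsMoufangLine fun i => v (k + i) := by
  obtain ⟨L, hL, hg, hr⟩ := hv
  exact ⟨L, hL, hg.shift k, hr ▸ (Equiv.addLeft k).surjective.range_comp v⟩

theorem reflect : T.IsMoufangLine fun i => v (-i) := by
  obtain ⟨L, hL, hg, hr⟩ := hv
  exact ⟨L, hL, hg.reflect, hr ▸ neg_surjective.range_comp v⟩

/-- The group `U_a` of the twin root `a` starting at `v 0` is transitive on the neighbours of `v 0`
outside `a`. -/
theorem exists_fix_half {x x' : V} (hx : T.pos.Adj (v 0) x) (hx' : T.pos.Adj (v 0) x')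
    (hne : x ≠ v 1) (hne' : x' ≠ v 1) :
    ∃ g ∈ T.aut, (∀ i, 0 ≤ i → g.1 (v i) = v i) ∧ g.1 x = x' := by
  obtain ⟨L, hL, hg, hr⟩ := hv
  obtain ⟨w, C, hw⟩ := L.exists_isTwinChart hg hr
  obtain ⟨v₁, w₁, C₁, hv₁, rfl, hw₁⟩ := C.exists_extension hx hne
  obtain ⟨v₂, w₂, C₂, hv₂, rfl, hw₂⟩ := C.exists_extension hx' hne'
  let a : L.TwinRoot := ⟨v, hg, hr⟩
  have hneg : ∀ w' : ℤ → W, (∀ j ≤ 0, w' j = w j) → a.negHalf ⊆ Set.range w' := by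
    rintro w' hw' y ⟨hy, i, hi, h0⟩
    rw [← hw] at hy
    obtain ⟨j, rfl⟩ := hy
    obtain rfl : i = j := C.codist_eq_zero_iff.1 h0
    exact ⟨i, hw' i hi⟩
  have hpos : ∀ v' : ℤ → V, (∀ i, 0 ≤ i → v' i = v i) → a.posHalf ⊆ Set.range v' := by
    rintro v' hv' _ ⟨i, hi, rfl⟩
    exact ⟨i, hv' i hi⟩
  obtain ⟨g, hgU, hgp, -⟩ := hL a C₁.toTwinApartment C₂.toTwinApartment (hpos _ hv₁)
    (hneg _ hw₁) (hpos _ hv₂) (hneg _ hw₂)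
  have hfix : ∀ i, 0 ≤ i → g.1 (v i) = v i := fun i hi => hgU.2.1 _ ⟨i, hi, rfl⟩
  refine ⟨g, hgU.1, hfix, ?_⟩
  have hmem : g.1 (v₁ (-1)) ∈ Set.range v₂ := by
    have : g.1 (v₁ (-1)) ∈ g.1 '' Set.range v₁ := ⟨_, ⟨-1, rfl⟩, rfl⟩
    rw [show g.1 '' Set.range v₁ = Set.range v₂ from hgp] at this
    exact this
  obtain ⟨k, hk⟩ := hmem
  have hadj : T.pos.Adj (v₂ 0) (v₂ k) := by
    rw [hk, hv₂ 0 le_rfl, ← hfix 0 le_rfl]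
    exact g.1.map_adj_iff.2 hx
  have hk1 : k ≠ 1 := by
    rintro rfl
    rw [hv₂ 1 (by omega), ← hfix 1 (by omega)] at hk
    exact hne (g.1.injective hk).symm
  have hd := C₂.geodesic_pos 0 k
  rw [SimpleGraph.dist_eq_one_iff_adj.2 hadj, zero_sub, abs_neg, Nat.cast_one] at hd
  obtain rfl : k = -1 := ((abs_eq zero_le_one).1 hd.symm).resolve_left hk1
  exact hk.symm

/-- With at least three neighbours of `v 0`, there is one off the line, to which every other one can
be moved by the root group of one of the two twin roots starting at `v 0`. -/
theorem exists_fix_adj (hthick : T.IsThick) {x x' : V} (hx : T.pos.Adj (v 0) x)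
    (hx' : T.pos.Adj (v 0) x') : ∃ g ∈ T.aut, g.1 (v 0) = v 0 ∧ g.1 x = x' := by
  obtain ⟨z, hz, hz1, hz2⟩ : ∃ z, T.pos.Adj (v 0) z ∧ z ≠ v 1 ∧ z ≠ v (-1) := by
    by_contra! hcon
    have h2 : (T.pos.neighborSet (v 0)).encard ≤ ({v 1, v (-1)} : Set V).encard :=
      Set.encard_le_encard fun z hz => or_iff_not_imp_left.2 (hcon z hz)
    rw [Set.encard_pair (hv.geodesic.injective.ne (by omega))] at h2
    exact absurd ((hthick.1 (v 0)).trans h2) (by norm_num)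
  have key : ∀ x, T.pos.Adj (v 0) x → ∃ g ∈ T.aut, g.1 (v 0) = v 0 ∧ g.1 x = z := by
    intro x hx
    by_cases hx1 : x = v 1
    · have h1 := hv.geodesic.injective.ne (show (1 : ℤ) ≠ -1 by omega)
      obtain ⟨g, hg, hf, he⟩ := hv.reflect.exists_fix_half (x := x) (x' := z) (by simpa using hx)
        (by simpa using hz) (hx1 ▸ h1) hz2
      exact ⟨g, hg, by simpa using hf 0 le_rfl, he⟩
    · obtain ⟨g, hg, hf, he⟩ := hv.exists_fix_half hx hz hx1 hz1
      exact ⟨g, hg, hf 0 le_rfl, he⟩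
  obtain ⟨g, hg, g0, gx⟩ := key x hx
  obtain ⟨k, hk, k0, kx⟩ := key x' hx'
  refine ⟨k⁻¹ * g, mul_mem (inv_mem hk) hg, ?_, ?_⟩
  · change k.1.symm (g.1 (v 0)) = v 0
    rw [g0, RelIso.symm_apply_eq, k0]
  · change k.1.symm (g.1 x) = x'
    rw [gx, RelIso.symm_apply_eq, kx]

/-- Walks without backtracking starting at `v 0` can be straightened to a segment of the line: a
root group fixing the segment reached so far moves the next vertex onto the line. -/
theorem exists_map_path (hthick : T.IsThick) {f : ℕ → V} {n : ℕ} (hf : T.pos.IsReducedPath f n)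
    (h0 : f 0 = v 0) : ∃ g ∈ T.aut, ∀ i ≤ n, g.1 (f i) = v i := by
  induction n with
  | zero =>
    refine ⟨1, one_mem _, fun i hi => ?_⟩
    obtain rfl : i = 0 := by omega
    exact h0
  | succ n ih =>
    obtain ⟨g, hg, hgf⟩ := ih (hf.mono n.le_succ)
    have hadj : T.pos.Adj (v n) (g.1 (f (n + 1))) := by
      rw [← hgf n le_rfl]
      exact g.1.map_adj_iff.2 (hf.adj n (by omega))
    obtain ⟨k, hk, hkv, hk1⟩ : ∃ k ∈ T.aut, (∀ i : ℕ, i ≤ n → k.1 (v i) = v i) ∧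
        k.1 (g.1 (f (n + 1))) = v (n + 1) := by
      rcases Nat.eq_zero_or_pos n with rfl | hn
      · obtain ⟨k, hk, k0, k1⟩ := hv.exists_fix_adj hthick hadj (hv.adj 0)
        refine ⟨k, hk, fun i hi => ?_, by simpa using k1⟩
        obtain rfl : i = 0 := by omega
        exact k0
      · obtain ⟨k, hk, k0, k1⟩ := (hv.shift n).reflect.exists_fix_half
          (x := g.1 (f (n + 1))) (x' := v (n + 1)) (by simpa using hadj)
          (by simpa using hv.adj n)
          (by
            intro e
            rw [show (n : ℤ) + -1 = (n - 1 : ℕ) by omega, ← hgf (n - 1) (by omega)] at e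
            refine hf.ne (n - 1) (by omega) (g.1.injective ?_)
            rw [← e, show n - 1 + 2 = n + 1 by omega])
          (hv.geodesic.injective.ne (by omega))
        refine ⟨k, hk, fun i hi => ?_, k1⟩
        have := k0 (n - i) (by omega)
        rwa [show (n : ℤ) + -(n - i) = i by ring] at this
    refine ⟨k * g, mul_mem hk hg, fun i hi => ?_⟩
    change k.1 (g.1 (f i)) = v i
    rcases hi.lt_or_eq with hi | rfl
    · rw [hgf i (by omega), hkv i (by omega)]
    · rw [hk1]
      push_cast
      rfl

/-- Rotating around `v (i + 1)` shows that all vertices of the line whose numbers have the same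
parity are equivalent. -/
theorem exists_map_even (hthick : T.IsThick) (i : ℤ) (k : ℕ) :
    ∃ g ∈ T.aut, g.1 (v (i + 2 * k)) = v i := by
  induction k with
  | zero => exact ⟨1, one_mem _, by simp⟩
  | succ k ih =>
    obtain ⟨g, hg, hgv⟩ := ih
    obtain ⟨u, hu, -, hu1⟩ := (hv.shift (i + 2 * k + 1)).exists_fix_adj hthick
      (x := v (i + 2 * k + 1 + 1)) (x' := v (i + 2 * k + 1 - 1)) (by simpa using hv.adj _)
      (by simpa using hv.adj_pred (i + 2 * k + 1))
    refine ⟨g * u, mul_mem hg hu, ?_⟩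
    change g.1 (u.1 _) = _
    rw [show i + 2 * (k + 1 : ℕ) = i + 2 * k + 1 + 1 by push_cast; ring, hu1, add_sub_cancel_right,
      hgv]

theorem exists_map_vertex (hthick : T.IsThick) (p : V) :
    ∃ g ∈ T.aut, ∃ i, g.1 p = v i := by
  obtain ⟨f, hf, h0, h1⟩ := T.pos_connected.exists_isReducedPath (v 0) p
  obtain ⟨g, hg, hgf⟩ := hv.exists_map_path hthick hf h0
  exact ⟨g, hg, _, h1 ▸ hgf _ le_rfl⟩

theorem exists_map_sameType (hthick : T.IsThick) {p q : V} (h : T.pos.SameType p q) :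
    ∃ g ∈ T.aut, g.1 q = p := by
  obtain ⟨g, hg, i, hgp⟩ := hv.exists_map_vertex hthick p
  obtain ⟨k, hk⟩ := even_iff_two_dvd.1 h
  rw [← T.pos_connected.dist_map g.1] at hk
  obtain ⟨f, hf, h0, h1⟩ := T.pos_connected.exists_isReducedPath (g.1 p) (g.1 q)
  obtain ⟨u, hu, huf⟩ := (hv.shift i).exists_map_path hthick hf (by simpa [hgp] using h0)
  have huq := huf _ le_rfl
  rw [h1, hk] at huq
  push_cast at huq
  obtain ⟨t, ht, htv⟩ := hv.exists_map_even hthick i k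
  refine ⟨g⁻¹ * (t * (u * g)), mul_mem (inv_mem hg) (mul_mem ht (mul_mem hu hg)), ?_⟩
  change g.1.symm (t.1 (u.1 (g.1 q))) = p
  rw [huq, htv, RelIso.symm_apply_eq, hgp]

end IsMoufangLine

theorem exists_aut_map_segment (hthick : T.IsThick) (hT : T.IsMoufang) {n : ℕ}
    {p q : Fin (n + 1) → V} (hp : T.pos.IsGeodesicSegment p) (hq : T.pos.IsGeodesicSegment q)
    (hpq : T.pos.SameType (p 0) (q 0)) : ∃ g ∈ T.aut, ∀ i, g.1 (p i) = q i := by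
  obtain ⟨v, hv⟩ := hT.exists_isMoufangLine
  obtain ⟨g, hg, hgq⟩ := hv.exists_map_sameType hthick hpq
  obtain ⟨t, ht, i, hti⟩ := hv.exists_map_vertex hthick (p 0)
  obtain ⟨f, hf, hfp⟩ := hp.exists_isReducedPath
  obtain ⟨f', hf', hfq⟩ := hq.exists_isReducedPath
  obtain ⟨a, ha, haf⟩ := (hv.shift i).exists_map_path hthick (hf.map t.1)
    (by have := hfp 0; simp only [Fin.val_zero] at this; simp [this, hti])
  obtain ⟨b, hb, hbf⟩ := (hv.shift i).exists_map_path hthick ((hf'.map g.1).map t.1)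
    (by have := hfq 0; simp only [Fin.val_zero] at this; simp [this, hgq, hti])
  refine ⟨(b * (t * g))⁻¹ * (a * t), mul_mem (inv_mem (mul_mem hb (mul_mem ht hg)))
    (mul_mem ha ht), fun k => ?_⟩
  change (b * (t * g)).1.symm (a.1 (t.1 (p k))) = q k
  rw [RelIso.symm_apply_eq, ← hfp, ← hfq, haf k (by omega)]
  exact (hbf k (by omega)).symm

/-- Types are the classes of a two-colouring, so vertices of the type opposite to that of `p` have
the same type. -/
theorem sameType_of_not (T : TwinTree V W) {p q r : V} (h₁ : ¬ T.pos.SameType p q)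
    (h₂ : ¬ T.pos.SameType p r) : T.pos.SameType q r := by
  obtain ⟨y⟩ := T.neg_connected.nonempty
  have H := (T.isCodistance_pos y).dist_add_even T.pos_connected
  have e1 := H p q
  have e2 := H p r
  have e3 := H q r
  simp only [SimpleGraph.SameType, Nat.even_iff] at *
  omega

theorem exists_aut_map_segment_of_typeExchanging (hthick : T.IsThick) (hT : T.IsMoufang)
    {α : T.AutProd} (hα : α ∈ T.aut) (hα' : T.pos.IsTypeExchanging α.1) {n : ℕ}
    {p q : Fin (n + 1) → V} (hp : T.pos.IsGeodesicSegment p) (hq : T.pos.IsGeodesicSegment q) :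
    ∃ g ∈ T.aut, ∀ i, g.1 (p i) = q i := by
  by_cases hpq : T.pos.SameType (p 0) (q 0)
  · exact exists_aut_map_segment hthick hT hp hq hpq
  · obtain ⟨g, hg, hgp⟩ := exists_aut_map_segment hthick hT (hp.map T.pos_connected α.1) hq
      (T.sameType_of_not (hα' (p 0)) hpq)
    exact ⟨g * α, mul_mem hg hα, hgp⟩

end TwinTree

/-! ### Commensurability of point stabilizers -/

namespace SimpleGraph

variable {X : Type*} {G : SimpleGraph X}

theorem finite_setOf_walk_length (hfin : ∀ u, (G.neighborSet u).Finite) (d : ℕ) (u : X) :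
    {v | ∃ p : G.Walk u v, p.length = d}.Finite := by
  induction d generalizing u with
  | zero =>
    refine (Set.finite_singleton u).subset ?_
    rintro v ⟨p, hp⟩
    exact (Walk.eq_of_length_eq_zero hp).symm
  | succ d ih =>
    refine ((hfin u).biUnion fun z _ => ih z).subset ?_
    rintro v ⟨p, hp⟩
    cases p with
    | nil => simp at hp
    | cons a p => exact Set.mem_biUnion a ⟨p, by simpa using hp⟩

namespace Point

theorem weight_smul (g : G ≃g G) (x : G.Point) : (g • x).weight = x.weight.mapDomain g := rfl

theorem exists_weight_ne_zero (x : G.Point) : ∃ u, x.weight u ≠ 0 := by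
  classical
  obtain ⟨u, v, t, -, -, -, hw⟩ := x.mem_edge
  by_contra! h
  have hu := h u
  have hv := h v
  rw [hw, Finsupp.add_apply, Finsupp.single_apply, Finsupp.single_apply] at hu hv
  by_cases huv : u = v
  · subst huv
    simp at hu
  · simp [huv, Ne.symm huv] at hu hv
    linarith

/-- In a locally finite tree the stabilizer of a point `x` moves a vertex `w` only finitely often:
the images of `w` are at a fixed distance from the finitely many vertices of the cell of `x`. -/
theorem relIndex_stabilizer_vertex (hfin : ∀ u, (G.neighborSet u).Finite) (hG : G.Connected)
    (x : G.Point) (w : X) :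
    (MulAction.stabilizer (G ≃g G) w).relIndex (MulAction.stabilizer (G ≃g G) x) ≠ 0 := by
  set S := MulAction.stabilizer (G ≃g G) x with hS
  have hstab : (MulAction.stabilizer (G ≃g G) w).subgroupOf S = MulAction.stabilizer S w := rfl
  rw [Subgroup.relIndex, hstab, MulAction.index_stabilizer]
  obtain ⟨u, hu⟩ := x.exists_weight_ne_zero
  obtain ⟨p⟩ := hG u w
  have hfinite : (MulAction.orbit S w).Finite := by
    refine (x.weight.support.finite_toSet.biUnion fun z _ =>
      finite_setOf_walk_length hfin p.length z).subset ?_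
    rintro _ ⟨⟨g, hg⟩, rfl⟩
    have hgx : x.weight.mapDomain g = x.weight := congrArg Point.weight hg
    refine Set.mem_biUnion (x := g u) ?_ ⟨p.map g.toHom, Walk.length_map _ _⟩
    rw [Finset.mem_coe, Finsupp.mem_support_iff, ← hgx, Finsupp.mapDomain_apply g.injective]
    exact hu
  exact (Set.ncard_pos hfinite).2 ⟨w, MulAction.mem_orbit_self w⟩ |>.ne'

theorem relIndex_stabilizer (hfin : ∀ u, (G.neighborSet u).Finite) (hG : G.Connected)
    (x x' : G.Point) :
    (MulAction.stabilizer (G ≃g G) x').relIndex (MulAction.stabilizer (G ≃g G) x) ≠ 0 := by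
  obtain ⟨u, v, t, -, -, -, hw⟩ := x'.mem_edge
  have hle : MulAction.stabilizer (G ≃g G) u ⊓ MulAction.stabilizer (G ≃g G) v ≤
      MulAction.stabilizer (G ≃g G) x' := by
    rintro g ⟨hu, hv⟩
    refine Point.ext ?_
    rw [weight_smul, hw, Finsupp.mapDomain_add, Finsupp.mapDomain_single, Finsupp.mapDomain_single,
      show g u = u from hu, show g v = v from hv]
  exact fun h => Subgroup.relIndex_inf_ne_zero (relIndex_stabilizer_vertex hfin hG x u)
    (relIndex_stabilizer_vertex hfin hG x v) (Subgroup.relIndex_eq_zero_of_le_left hle h)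

end Point

end SimpleGraph

namespace TwinTree

variable {V W : Type*} {T : TwinTree V W}

theorem relIndex_stab (hfin : T.IsLocallyFinite) (H : Subgroup T.AutProd) (x x' : T.neg.Point) :
    (T.stab H x').relIndex (T.stab H x) ≠ 0 := by
  refine Subgroup.relIndex_inf_ne_zero ?_ ?_
  · have h1 : H.relIndex (T.stab H x) = 1 := Subgroup.relIndex_eq_one.2 inf_le_left
    exact h1 ▸ one_ne_zero
  · rw [Subgroup.relIndex_comap]
    intro h
    refine SimpleGraph.Point.relIndex_stabilizer hfin.2 T.neg_connected x x'
      (Subgroup.relIndex_eq_zero_of_le_right ?_ h)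
    rw [Subgroup.map_le_iff_le_comap]
    exact inf_le_right

theorem commensurable_stab (hfin : T.IsLocallyFinite) (H : Subgroup T.AutProd)
    (x x' : T.neg.Point) : Subgroup.Commensurable (T.stab H x) (T.stab H x') :=
  ⟨relIndex_stab hfin H x' x, relIndex_stab hfin H x x'⟩

theorem _root_.Subgroup.Commensurable.map {A B : Type*} [Group A] [Group B] {H K : Subgroup A}
    (h : Subgroup.Commensurable H K) (f : A →* B) :
    Subgroup.Commensurable (H.map f) (K.map f) := by
  constructor
  · rw [← Subgroup.relIndex_comap]
    exact fun h0 => h.1 (Subgroup.relIndex_eq_zero_of_le_left (Subgroup.le_comap_map f H) h0)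
  · rw [← Subgroup.relIndex_comap]
    exact fun h0 => h.2 (Subgroup.relIndex_eq_zero_of_le_left (Subgroup.le_comap_map f K) h0)

theorem commensurable_Γ (hfin : T.IsLocallyFinite) (x x' : T.neg.Point) :
    Subgroup.Commensurable (T.Γ x) (T.Γ x') :=
  (commensurable_stab hfin _ x x').map _

/-! ### Automorphisms normalize the group generated by the root groups -/

/-- The image of a twin apartment under an automorphism of the twin tree. -/
def TwinApartment.map (L : T.TwinApartment) {g : T.AutProd} (hg : g ∈ T.aut) :
    T.TwinApartment where
  posLine := g.1 '' L.posLine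
  negLine := g.2 '' L.negLine
  posLine_geodesic := by
    obtain ⟨f, hf, hr⟩ := L.posLine_geodesic
    exact ⟨_, hf.map T.pos_connected g.1, by rw [← hr, ← Set.range_comp]; rfl⟩
  negLine_geodesic := by
    obtain ⟨f, hf, hr⟩ := L.negLine_geodesic
    exact ⟨_, hf.map T.neg_connected g.2, by rw [← hr, ← Set.range_comp]; rfl⟩
  opposite_pos := by
    rintro _ ⟨x, hx, rfl⟩
    obtain ⟨y, ⟨hy, h0⟩, hu⟩ := L.opposite_pos x hx
    refine ⟨g.2 y, ⟨⟨y, hy, rfl⟩, (hg x y).trans h0⟩, ?_⟩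
    rintro _ ⟨⟨y', hy', rfl⟩, h⟩
    rw [hu y' ⟨hy', (hg x y').symm.trans h⟩]
  opposite_neg := by
    rintro _ ⟨y, hy, rfl⟩
    obtain ⟨x, ⟨hx, h0⟩, hu⟩ := L.opposite_neg y hy
    refine ⟨g.1 x, ⟨⟨x, hx, rfl⟩, (hg x y).trans h0⟩, ?_⟩
    rintro _ ⟨⟨x', hx', rfl⟩, h⟩
    rw [hu x' ⟨hx', (hg x' y).symm.trans h⟩]

namespace TwinApartment.TwinRoot

variable {L : T.TwinApartment} (a : L.TwinRoot) {g : T.AutProd} (hg : g ∈ T.aut)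

/-- The image of a twin root under an automorphism of the twin tree. -/
def map : (L.map hg).TwinRoot where
  chart i := g.1 (a.chart i)
  chart_geodesic := a.chart_geodesic.map T.pos_connected g.1
  range_chart := by
    change Set.range (g.1 ∘ a.chart) = g.1 '' L.posLine
    rw [Set.range_comp, a.range_chart]

theorem posHalf_map : (a.map hg).posHalf = g.1 '' a.posHalf := by
  ext x
  constructor
  · rintro ⟨i, hi, rfl⟩
    exact ⟨_, ⟨i, hi, rfl⟩, rfl⟩
  · rintro ⟨_, ⟨i, hi, rfl⟩, rfl⟩
    exact ⟨i, hi, rfl⟩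

theorem posInterior_map : (a.map hg).posInterior = g.1 '' a.posInterior := by
  ext x
  constructor
  · rintro ⟨i, hi, rfl⟩
    exact ⟨_, ⟨i, hi, rfl⟩, rfl⟩
  · rintro ⟨_, ⟨i, hi, rfl⟩, rfl⟩
    exact ⟨i, hi, rfl⟩

theorem negHalf_map : (a.map hg).negHalf = g.2 '' a.negHalf := by
  ext y
  constructor
  · rintro ⟨⟨y, hy, rfl⟩, i, hi, h0⟩
    exact ⟨y, ⟨hy, i, hi, (hg _ _).symm.trans h0⟩, rfl⟩
  · rintro ⟨y, ⟨hy, i, hi, h0⟩, rfl⟩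
    exact ⟨⟨y, hy, rfl⟩, i, hi, (hg _ _).trans h0⟩

theorem negInterior_map : (a.map hg).negInterior = g.2 '' a.negInterior := by
  ext y
  constructor
  · rintro ⟨⟨y, hy, rfl⟩, i, hi, h0⟩
    exact ⟨y, ⟨hy, i, hi, (hg _ _).symm.trans h0⟩, rfl⟩
  · rintro ⟨y, ⟨hy, i, hi, h0⟩, rfl⟩
    exact ⟨⟨y, hy, rfl⟩, i, hi, (hg _ _).trans h0⟩

theorem conj_mem_U_map {u : T.AutProd} (hu : u ∈ a.U) : g * u * g⁻¹ ∈ (a.map hg).U := by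
  have e1 : ∀ x, u.1 x = x → (g * u * g⁻¹).1 (g.1 x) = g.1 x := fun x hx => by
    change g.1 (u.1 (g.1.symm (g.1 x))) = _
    rw [RelIso.symm_apply_apply, hx]
  have e2 : ∀ y, u.2 y = y → (g * u * g⁻¹).2 (g.2 y) = g.2 y := fun y hy => by
    change g.2 (u.2 (g.2.symm (g.2 y))) = _
    rw [RelIso.symm_apply_apply, hy]
  obtain ⟨h0, h1, h2, h3, h4⟩ := hu
  refine ⟨mul_mem (mul_mem hg h0) (inv_mem hg), ?_, ?_, ?_, ?_⟩
  · rw [posHalf_map]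
    rintro _ ⟨x, hx, rfl⟩
    exact e1 x (h1 x hx)
  · rw [negHalf_map]
    rintro _ ⟨y, hy, rfl⟩
    exact e2 y (h2 y hy)
  · rw [posInterior_map]
    rintro _ ⟨v, hv, rfl⟩ x hx
    obtain ⟨x, rfl⟩ := g.1.surjective x
    exact e1 x (h3 v hv x (g.1.map_adj_iff.1 hx))
  · rw [negInterior_map]
    rintro _ ⟨v, hv, rfl⟩ y hy
    obtain ⟨y, rfl⟩ := g.2.surjective y
    exact e2 y (h4 v hv y (g.2.map_adj_iff.1 hy))

variable {a} in
theorem IsRootGroup.map (ha : a.IsRootGroup) : (a.map hg).IsRootGroup := by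
  have p1 : ∀ S : Set V, g.1 '' a.posHalf ⊆ S → a.posHalf ⊆ g⁻¹.1 '' S := fun S h x hx =>
    ⟨g.1 x, h ⟨x, hx, rfl⟩, g.1.symm_apply_apply x⟩
  have p2 : ∀ S : Set W, g.2 '' a.negHalf ⊆ S → a.negHalf ⊆ g⁻¹.2 '' S := fun S h y hy =>
    ⟨g.2 y, h ⟨y, hy, rfl⟩, g.2.symm_apply_apply y⟩
  intro M N hM hM' hN hN'
  rw [posHalf_map] at hM hN
  rw [negHalf_map] at hM' hN'
  obtain ⟨u, hu, h1, h2⟩ := ha (M.map (inv_mem hg)) (N.map (inv_mem hg)) (p1 _ hM) (p2 _ hM')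
    (p1 _ hN) (p2 _ hN')
  refine ⟨_, a.conj_mem_U_map hg hu, ?_, ?_⟩
  · have : g.1 '' (u.1 '' (g⁻¹.1 '' M.posLine)) = g.1 '' (g⁻¹.1 '' N.posLine) := congrArg _ h1
    simp only [Set.image_image] at this
    refine this.trans ?_
    simp
  · have : g.2 '' (u.2 '' (g⁻¹.2 '' M.negLine)) = g.2 '' (g⁻¹.2 '' N.negLine) := congrArg _ h2
    simp only [Set.image_image] at this
    refine this.trans ?_
    simp

end TwinApartment.TwinRoot

theorem conj_mem_rootGroupsSubgroup {g l : T.AutProd} (hg : g ∈ T.aut)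
    (hl : l ∈ T.rootGroupsSubgroup) : g * l * g⁻¹ ∈ T.rootGroupsSubgroup := by
  have : T.rootGroupsSubgroup ≤ T.rootGroupsSubgroup.comap (MulAut.conj g).toMonoidHom := by
    refine (Subgroup.closure_le _).2 ?_
    rintro u ⟨L, a, ha, hu⟩
    exact Subgroup.subset_closure ⟨_, _, ha.map hg, a.conj_mem_U_map hg hu⟩
  exact this hl

open scoped Pointwise in
theorem conj_smul_Γ_le {g : T.AutProd} (hg : g ∈ T.aut) (x : T.neg.Point) :
    ConjAct.toConjAct g.1 • T.Γ x ≤ T.Γ (g.2 • x) := by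
  rintro _ ⟨_, ⟨l, ⟨hl, hlx⟩, rfl⟩, rfl⟩
  refine ⟨g * l * g⁻¹, ⟨conj_mem_rootGroupsSubgroup hg hl, ?_⟩, rfl⟩
  change (g.2 * l.2 * g.2⁻¹) • g.2 • x = g.2 • x
  rw [mul_smul, inv_smul_smul, mul_smul, show l.2 • x = x from hlx]

open scoped Pointwise in
theorem conj_smul_Γ {g : T.AutProd} (hg : g ∈ T.aut) (x : T.neg.Point) :
    ConjAct.toConjAct g.1 • T.Γ x = T.Γ (g.2 • x) := by
  refine (conj_smul_Γ_le hg x).antisymm ?_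
  have := conj_smul_Γ_le (inv_mem hg) (g.2 • x)
  rw [Prod.fst_inv, Prod.snd_inv, inv_smul_smul, map_inv, Subgroup.pointwise_smul_subset_iff,
    inv_inv] at this
  exact this

theorem aut_map_toPos_le_commΓ (hfin : T.IsLocallyFinite) (x : T.neg.Point) :
    T.aut.map T.toPos ≤ T.commΓ x := by
  rintro _ ⟨g, hg, rfl⟩
  refine (Subgroup.Commensurable.commensurator_mem_iff _ _).2 ?_
  rw [show T.toPos g = g.1 from rfl, conj_smul_Γ hg]
  exact commensurable_Γ hfin _ _

/-! ### The codistance separates the vertices of one tree -/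

/-- If `y` and `z` are adjacent vertices of `T₋`, then `z` is the upper neighbour of `y` with
respect to vertices of arbitrarily large codistance. -/
theorem exists_codist_adj (hthick : T.IsThick) {y z : W} (hyz : T.neg.Adj y z) (m : ℕ) :
    ∃ x, T.codist x y = m + 1 ∧ T.codist x z = m + 2 := by
  induction m with
  | zero =>
    have := T.pos_connected.nonempty
    obtain ⟨x, hx⟩ := (T.isCodistance_pos y).exists_eq_zero fun x =>
      Set.one_lt_encard_iff_nontrivial.1 (lt_of_lt_of_le (by norm_num) (hthick.1 x))
    have hz := (T.isCodistance_neg x).adj_of_zero hx hyz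
    obtain ⟨x', hxx', hx'⟩ := (T.isCodistance_pos z).exists_up (y := x) (by omega)
    exact ⟨x', (T.isCodistance_pos y).adj_of_zero hx hxx', by omega⟩
  | succ m ih =>
    obtain ⟨x, hxy, hxz⟩ := ih
    obtain ⟨x', hxx', hx'⟩ := (T.isCodistance_pos z).exists_up (y := x) (by omega)
    have e1 := T.codist_pos_adj x x' y hxx'
    have e2 := T.codist_neg_adj x' y z hyz
    exact ⟨x', by omega, by omega⟩

theorem exists_codist_ne (hthick : T.IsThick) {y y' : W} (hne : y ≠ y') :
    ∃ x, T.codist x y ≠ T.codist x y' := by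
  obtain ⟨f, hf, h0, h1⟩ := T.neg_connected.exists_isReducedPath y y'
  have hd := T.neg_connected.pos_dist_of_ne hne
  obtain ⟨z, hz, hzf⟩ := (Set.one_lt_encard_iff_nontrivial.1
    (lt_of_lt_of_le (by norm_num) (hthick.2 y))).exists_ne (f 1)
  -- seen from a remote `x` whose direction at `y` is `z`, the path from `y` to `y'` descends
  obtain ⟨x, hxy, hxz⟩ := exists_codist_adj hthick hz (T.neg.dist y y' - 1)
  refine ⟨x, fun e => ?_⟩
  have ha := hf.adj 0 hd
  rw [h0] at ha
  have hf1 : T.codist x (f 1) = T.neg.dist y y' - 1 := by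
    rcases T.codist_neg_adj x _ _ ha with e1 | e1
    · exact absurd ((T.isCodistance_neg x).eq_of_up (by omega) hz ha (by omega) e1) hzf
    · change T.codist x (f 1) + 1 = _ at e1
      omega
  have := (T.isCodistance_neg x).descend hf (by rw [h0, hxy]) hf1 (by omega) _ le_rfl
  rw [h1] at this
  omega

theorem injOn_toPos (hthick : T.IsThick) : Set.InjOn T.toPos T.aut := by
  intro g hg g' hg' e
  have e1 : g.1 = g'.1 := e
  refine Prod.ext e1 (RelIso.ext fun y => ?_)
  by_contra hne
  obtain ⟨x, hx⟩ := exists_codist_ne hthick hne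
  obtain ⟨x, rfl⟩ := g.1.surjective x
  refine hx ((hg x y).trans ?_)
  rw [e1]
  exact (hg' x y).symm

end TwinTree

theorem mainTheorem10 {V W : Type*} (T : TwinTree V W)
    (hthick : T.IsThick) (hfin : T.IsLocallyFinite) (hmoufang : T.IsMoufang) :
    (∀ x x' : T.neg.Point, Subgroup.Commensurable (T.stab T.aut x) (T.stab T.aut x')) ∧
    (Set.InjOn T.toPos T.aut ∧ ∀ x : T.neg.Point, T.aut.map T.toPos ≤ T.commΓ x) ∧
    (∀ x : T.neg.Point,
      (∀ (n : ℕ) (p q : Fin (n + 1) → V),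
        T.pos.IsGeodesicSegment p → T.pos.IsGeodesicSegment q → T.pos.SameType (p 0) (q 0) →
        ∃ g ∈ T.commΓ x, ∀ i, g (p i) = q i) ∧
      ((∃ α ∈ T.aut, T.pos.IsTypeExchanging (T.toPos α)) →
        ∀ (n : ℕ) (p q : Fin (n + 1) → V),
          T.pos.IsGeodesicSegment p → T.pos.IsGeodesicSegment q →
          ∃ g ∈ T.commΓ x, ∀ i, g (p i) = q i)) := by
  have hcomm := TwinTree.aut_map_toPos_le_commΓ hfin
  refine ⟨TwinTree.commensurable_stab hfin _, ⟨TwinTree.injOn_toPos hthick, hcomm⟩, fun x =>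
    ⟨fun n p q hp hq hpq => ?_, ?_⟩⟩
  · obtain ⟨g, hg, hgp⟩ := TwinTree.exists_aut_map_segment hthick hmoufang hp hq hpq
    exact ⟨g.1, hcomm x ⟨g, hg, rfl⟩, hgp⟩
  · rintro ⟨α, hα, hα'⟩ n p q hp hq
    obtain ⟨g, hg, hgp⟩ :=
      TwinTree.exists_aut_map_segment_of_typeExchanging hthick hmoufang hα hα' hp hq
    exact ⟨g.1, hcomm x ⟨g, hg, rfl⟩, hgp⟩
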